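/- Let $K$ be a field of characteristic $0$ (not necessarily algebraically closed), and let $F(X,Y)=Y^n+\sum_{i=1}^n \alpha_i(X)\,Y^{n-i}\in K[[X]][Y]$ be a monic polynomial in $Y$ that is separable over $K((X))$, i.e. $PF+QF_Y=1$ for some $P,Q\in K((X))[Y]$, where $F_Y$ is the derivative with respect to $Y$. Then there exist a triangular separable $K$-algebra $R$, an integer $m>0$, and power series $\eta_1,\dots,\eta_n\in R[[T]]$ such that $$F(T^m,Y)=\prod_{i=1}^n (Y-\eta_i)\quad\text{in } R[[T]][Y].$$ Here a triangular separable $K$-algebra is a $K$-algebra (up to isomorphism) $R=K[a_1,\dots,a_l]$, $l\ge 0$, obtained from $K$ by finitely many successive extensions $K[a_1,\dots,a_i]=K[a_1,\dots,a_{i-1}][X]/(p_i)$, where each $p_i$ is a monic, nonconstant, separable polynomial over $K[a_1,\dots,a_{i-1}]$; a polynomial $p$ over a commutative ring $A$ is separable if $rp+sp'=1$ for some $r,s\in A[X]$. The $p_i$ are not required to be irreducible, so $R$ need not be a field. -/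

import Mathlib

universe u

/-- `IsTriangularSeparable K R`: the `K`-algebra `R` is a triangular separable `K`-algebra, i.e.
`R = K[a₁, …, aₗ]` is obtained from `K` by finitely many successive extensions
`K[a₁, …, aᵢ] = K[a₁, …, aᵢ₋₁][X] / (pᵢ)`, where each `pᵢ` is a monic, nonconstant polynomial over
`K[a₁, …, aᵢ₋₁]` that is separable (`r * pᵢ + s * pᵢ' = 1` for some polynomials `r`, `s`).
The `pᵢ` need not be irreducible, so `R` need not be a field or an integral domain.
The notion is invariant under isomorphism of `K`-algebras. -/
inductive IsTriangularSeparable (K : Type u) [Field K] :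
    (R : Type u) → [CommRing R] → [Algebra K R] → Prop
  /-- The empty tower: `R` is `K` itself. -/
  | base (R : Type u) [CommRing R] [Algebra K R]
      (h : Function.Bijective (algebraMap K R)) : IsTriangularSeparable K R
  /-- One more extension: `S = R[a]`, `p(a) = 0`, that is `S = R[X] / (p)`. -/
  | adjoin (R S : Type u) [CommRing R] [Algebra K R] [CommRing S] [Algebra K S]
      [Algebra R S] [IsScalarTower K R S] (p : Polynomial R)
      (hR : IsTriangularSeparable K R)
      (monic : p.Monic) (pos : 0 < p.natDegree) (separable : p.Separable)
      (h : Nonempty (IsAdjoinRoot S p)) : IsTriangularSeparable K S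

/-- The substitution `F(X, Y) ↦ F(T ^ m, Y)` from `K⟦X⟧[Y]` to `R⟦T⟧[Y]`, for a `K`-algebra `R` and
`m ≠ 0`: each coefficient `α(X) = ∑ αᵢ Xⁱ` becomes `α(T ^ m) = ∑ αᵢ T ^ (m * i)`, where `αᵢ ∈ K` is
regarded as an element of `R`. -/
noncomputable def substPow {K : Type u} [Field K] (R : Type u) [CommRing R] [Algebra K R]
    (m : ℕ) (hm : m ≠ 0) (F : Polynomial (PowerSeries K)) : Polynomial (PowerSeries R) :=
  F.map ((PowerSeries.expand m hm : PowerSeries R →ₐ[R] PowerSeries R).toRingHom.comp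
    (PowerSeries.map (algebraMap K R)))

/-! The algebra `R` can be taken to be a finite field extension of `K`, which a primitive element
presents as a one-step tower. What has to be proved is then the Newton–Puiseux theorem, by induction
on the degree n, uniformly in the field.

A translation of Y removes the coefficient of Y^(n-1), which needs characteristic 0. Unless F is now
Y^n, the substitution X = T^q and the scaling of Y dictated by the smallest Newton slope give a
monic G whose constant term g = G(0,Y) is not Y^n. Over a splitting field of g its roots sum to 0
and are not all 0, so two of them differ and g is a product of two coprime monic factors of degree
below n. Hensel's lemma lifts this factorization to G, and the induction hypothesis applies to both
factors. -/

/-! ### Hensel lifting over power series -/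

section Hensel

open Polynomial

/-- Coprime monic polynomials `a`, `b` solve `a * v + b * u = e` with the expected degree bounds. -/
lemma Polynomial.exists_mul_add_mul_eq_of_isCoprime {R : Type*} [CommRing R] [Nontrivial R]
    {a b : R[X]} (ha : a.Monic) (hb : b.Monic) (hab : IsCoprime a b) {e : R[X]}
    (he : e.degree < (a.natDegree + b.natDegree : ℕ)) :
    ∃ u v : R[X], u.degree < a.degree ∧ v.degree < b.degree ∧ a * v + b * u = e := by
  obtain ⟨s, t, hst⟩ := hab
  have hu : ((e * t) %ₘ a).degree < a.degree := degree_modByMonic_lt _ ha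
  have hdvd : a * (e * s + b * ((e * t) /ₘ a)) + b * ((e * t) %ₘ a) = e := by
    linear_combination e * hst + b * modByMonic_add_div (e * t) a
  refine ⟨(e * t) %ₘ a, e * s + b * ((e * t) /ₘ a), hu, ?_, hdvd⟩
  -- The bound on the cofactor v of a comes from a * v = e - b * u: the right side has degree below
  -- deg a + deg b, and a is monic.
  have key : (a * (e * s + b * ((e * t) /ₘ a))).degree < a.degree + b.degree := by
    rw [eq_sub_of_add_eq hdvd]
    refine (degree_sub_le _ _).trans_lt (max_lt ?_ ?_)
    · rwa [degree_eq_natDegree ha.ne_zero, degree_eq_natDegree hb.ne_zero, ← Nat.cast_add]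
    · rw [mul_comm b, hb.degree_mul]
      rw [degree_eq_natDegree hb.ne_zero]
      exact WithBot.add_lt_add_right (WithBot.natCast_ne_bot _) hu
  rw [mul_comm, ha.degree_mul, add_comm, degree_eq_natDegree ha.ne_zero] at key
  exact lt_of_add_lt_add_left key

/-- The coefficient sequences of the two factors of a lifted factorization: the `j`-th term is
obtained from the previous ones by applying `solve` to the defect at level `j`. -/
noncomputable def henselSeq {A : Type*} [CommRing A] (solve : A → A × A) (e : ℕ → A)
    (a b : A) : ℕ → A × A
  | 0 => (a, b)
  -- The indices i + 1 and j - i are the pairs of positive integers with sum j + 1; the two products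
  -- with an index 0 are the unknowns of the linear equation.
  | j + 1 => solve (e (j + 1) - ∑ i : Fin j,
      (henselSeq solve e a b (i + 1)).1 * (henselSeq solve e a b (j - i)).2)
decreasing_by all_goals omega

/-- A sequence of polynomials, the coefficients of a power series in `T`, with the zeroth one monic
and the others of smaller degree, is the sequence of `T`-coefficients of a monic polynomial. -/
lemma Polynomial.exists_monic_coeff_coeff_eq {K : Type*} [CommRing K] [Nontrivial K]
    (A : ℕ → K[X]) (h0 : (A 0).Monic) (hA : ∀ j, (A (j + 1)).degree < (A 0).degree) :
    ∃ P : (PowerSeries K)[X], P.Monic ∧ P.natDegree = (A 0).natDegree ∧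
      ∀ i j, PowerSeries.coeff j (P.coeff i) = (A j).coeff i := by
  set k := (A 0).natDegree with hk
  have hz : ∀ i, k < i → ∀ j, (A j).coeff i = 0 := by
    intro i hi j
    rcases j with _ | j
    · exact coeff_eq_zero_of_natDegree_lt hi
    · refine coeff_eq_zero_of_degree_lt ((hA j).trans ?_)
      rw [degree_eq_natDegree h0.ne_zero]
      exact_mod_cast hi
  let P : (PowerSeries K)[X] :=
    ∑ i ∈ Finset.range (k + 1), monomial i (PowerSeries.mk fun j => (A j).coeff i)
  have hP : ∀ i j, PowerSeries.coeff j (P.coeff i) = (A j).coeff i := by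
    intro i j
    simp only [P, finsetSum_coeff, coeff_monomial, Finset.sum_ite_eq', Finset.mem_range]
    split_ifs with h
    · simp
    · rw [hz i (by omega), map_zero]
  have h1 : P.coeff k = 1 := by
    ext j
    rw [hP, PowerSeries.coeff_one]
    rcases j with _ | j
    · simpa only [if_true] using (show (A 0).coeff k = 1 from h0)
    · rw [if_neg (by simp)]
      refine coeff_eq_zero_of_degree_lt ((hA j).trans_eq ?_)
      rw [degree_eq_natDegree h0.ne_zero]
  have hle : P.natDegree ≤ k := by
    refine natDegree_le_iff_coeff_eq_zero.2 fun i hi => ?_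
    ext j
    rw [hP, hz i hi, map_zero]
  exact ⟨P, monic_of_natDegree_le_of_coeff_eq_one k hle h1,
    natDegree_eq_of_le_of_coeff_ne_zero hle (by rw [h1]; exact one_ne_zero), hP⟩

/-- Hensel's lemma for power series: a factorization of the constant term of a monic polynomial
into coprime monic factors lifts. -/
theorem Polynomial.exists_monic_mul_of_map_constantCoeff {K : Type*} [CommRing K] [Nontrivial K]
    {G : (PowerSeries K)[X]} (hG : G.Monic) {a b : K[X]} (ha : a.Monic) (hb : b.Monic)
    (hab : IsCoprime a b) (h : G.map PowerSeries.constantCoeff = a * b) :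
    ∃ P Q : (PowerSeries K)[X], P.Monic ∧ Q.Monic ∧ P.natDegree = a.natDegree ∧
      Q.natDegree = b.natDegree ∧ P * Q = G := by
  have hdeg : G.natDegree = a.natDegree + b.natDegree := by
    rw [← hG.natDegree_map PowerSeries.constantCoeff, h, ha.natDegree_mul hb]
  have hsol : ∀ e : K[X], ∃ uv : K[X] × K[X], e.degree < (a.natDegree + b.natDegree : ℕ) →
      uv.1.degree < a.degree ∧ uv.2.degree < b.degree ∧ a * uv.2 + b * uv.1 = e := by
    intro e
    by_cases he : e.degree < (a.natDegree + b.natDegree : ℕ)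
    · obtain ⟨u, v, huv⟩ := exists_mul_add_mul_eq_of_isCoprime ha hb hab he
      exact ⟨(u, v), fun _ => huv⟩
    · exact ⟨0, fun h => absurd h he⟩
  choose solve hsolve using hsol
  let e : ℕ → K[X] := fun j => ∑ i ∈ Finset.range (G.natDegree + 1),
    monomial i (PowerSeries.coeff j (G.coeff i))
  have he : ∀ i j, (e j).coeff i = PowerSeries.coeff j (G.coeff i) := by
    intro i j
    simp only [e, finsetSum_coeff, coeff_monomial, Finset.sum_ite_eq', Finset.mem_range]
    split_ifs with hi
    · rfl
    · rw [coeff_eq_zero_of_natDegree_lt (by omega), map_zero]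
  have he0 : e 0 = a * b := by
    rw [← h]
    ext i
    simp [he]
  have hedeg : ∀ j, (e (j + 1)).degree < (a.natDegree + b.natDegree : ℕ) := by
    intro j
    rw [degree_lt_iff_coeff_zero]
    intro m hm
    rw [he]
    rcases hm.eq_or_lt with rfl | hm
    · rw [← hdeg, hG.coeff_natDegree, PowerSeries.coeff_one, if_neg (by simp)]
    · rw [coeff_eq_zero_of_natDegree_lt (by omega), map_zero]
  let S := henselSeq solve e a b
  have hS0 : S 0 = (a, b) := by simp only [S, henselSeq]
  have hSs : ∀ j, S (j + 1) =
      solve (e (j + 1) - ∑ i : Fin j, (S (i + 1)).1 * (S (j - i)).2) := by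
    intro j
    simp only [S]
    rw [henselSeq]
  have hS : ∀ j, (S (j + 1)).1.degree < a.degree ∧ (S (j + 1)).2.degree < b.degree ∧
      a * (S (j + 1)).2 + b * (S (j + 1)).1 =
        e (j + 1) - ∑ i : Fin j, (S (i + 1)).1 * (S (j - i)).2 := by
    intro j
    induction j using Nat.strong_induction_on with
    | _ j ih =>
    rw [hSs j]
    apply hsolve
    -- `solve` is meaningful only below degree deg a + deg b. The cross terms satisfy this since
    -- both of their indices are positive and at most j.
    refine (degree_sub_le _ _).trans_lt (max_lt (hedeg j) ?_)
    refine (degree_sum_le _ _).trans_lt ?_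
    rw [Finset.sup_lt_iff (WithBot.bot_lt_coe _)]
    intro i _
    have h1 := (ih i i.2).1
    obtain ⟨l, hl⟩ : ∃ l, j - i = l + 1 := ⟨j - i - 1, by omega⟩
    have h2 := (ih l (by omega)).2.1
    rw [hl]
    refine (degree_mul_le _ _).trans_lt ?_
    rw [degree_eq_natDegree ha.ne_zero] at h1
    rw [degree_eq_natDegree hb.ne_zero] at h2
    rw [Nat.cast_add]
    exact (add_le_add_left h1.le _).trans_lt
      (WithBot.add_lt_add_left (WithBot.natCast_ne_bot _) h2)
  obtain ⟨P, hP, hPd, hPc⟩ := exists_monic_coeff_coeff_eq (fun j => (S j).1)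
    (by simpa only [hS0] using ha) (by simpa only [hS0] using fun j => (hS j).1)
  obtain ⟨Q, hQ, hQd, hQc⟩ := exists_monic_coeff_coeff_eq (fun j => (S j).2)
    (by simpa only [hS0] using hb) (by simpa only [hS0] using fun j => (hS j).2.1)
  refine ⟨P, Q, hP, hQ, by simpa only [hS0] using hPd, by simpa only [hS0] using hQd, ?_⟩
  have hsum : ∀ j, ∑ p ∈ Finset.HasAntidiagonal.antidiagonal j, (S p.1).1 * (S p.2).2 = e j := by
    intro j
    rw [Finset.Nat.sum_antidiagonal_eq_sum_range_succ (fun x y => (S x).1 * (S y).2)]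
    rcases j with _ | j
    · simp [hS0, he0]
    · rw [Finset.sum_range_succ, Finset.sum_range_succ']
      have := (hS j).2.2
      rw [Finset.sum_fin_eq_sum_range] at this
      rw [Finset.sum_congr rfl (g := fun i => if h : i < j then (S (i + 1)).1 * (S (j - i)).2
        else 0)]
      · simp only [hS0, Nat.sub_zero, Nat.sub_self]
        linear_combination this
      · intro i hi
        rw [dif_pos (Finset.mem_range.1 hi), Nat.add_sub_add_right]
  ext i j
  rw [← he, ← hsum, coeff_mul, map_sum, finsetSum_coeff]
  simp_rw [PowerSeries.coeff_mul, hPc, hQc, coeff_mul]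
  exact Finset.sum_comm

end Hensel
-- Translation and the Newton polygon
section Newton

open Polynomial

/-- In characteristic zero, a translation of the variable kills the subleading coefficient. -/
lemma Polynomial.exists_coeff_taylor_eq_zero {K : Type*} [Field K] [CharZero K]
    {F : (PowerSeries K)[X]} (hF : F.Monic) {n : ℕ} (hn : F.natDegree = n + 1) :
    ∃ c, (taylor c F).coeff n = 0 := by
  have hc (c : PowerSeries K) : (taylor c F).coeff n = F.coeff n + (n + 1) * c := by
    rw [taylor_coeff, eval_eq_sum_range' (n := 2)]
    · have : F.coeff (n + 1) = 1 := hn ▸ hF.coeff_natDegree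
      simp [Finset.sum_range_succ, hasseDeriv_coeff, add_comm 1 n, this]
    · have := natDegree_hasseDeriv_le F n
      omega
  refine ⟨-PowerSeries.C ((n + 1 : K)⁻¹) * F.coeff n, ?_⟩
  have h : ((n : PowerSeries K) + 1) * PowerSeries.C ((n + 1 : K)⁻¹) = 1 := by
    have h1 : ((n : PowerSeries K) + 1) = PowerSeries.C (n + 1 : K) := by simp
    rw [h1, ← map_mul, mul_inv_cancel₀ (by exact_mod_cast n.succ_ne_zero), map_one]
  rw [hc]
  linear_combination -F.coeff n * h

/-- The Newton polygon step: after the substitution `X = T ^ q`, a monic polynomial other than a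
power of the variable is obtained by scaling the variable by a power of `T` in a monic polynomial
whose constant term is not a power of the variable. -/
lemma Polynomial.exists_map_expand_eq_scaleRoots {K : Type*} [Field K]
    {F : (PowerSeries K)[X]} (hF : F.Monic) (hX : F ≠ X ^ F.natDegree) :
    ∃ (q : ℕ) (hq : q ≠ 0) (p : ℕ) (G : (PowerSeries K)[X]), G.Monic ∧
      G.natDegree = F.natDegree ∧
      F.map (PowerSeries.expand q hq : PowerSeries K →ₐ[K] PowerSeries K).toRingHom =
        G.scaleRoots (PowerSeries.X ^ p) ∧
      (∀ i, F.coeff i = 0 → G.coeff i = 0) ∧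
      ∃ i < F.natDegree, PowerSeries.constantCoeff (G.coeff i) ≠ 0 := by
  classical
  set n := F.natDegree with hn
  -- With q = n! every n - i divides q, so `w i`, which is q times the slope ord(α)/(n - i) for α =
  -- `F.coeff i`, is an integer.
  have hq : n.factorial ≠ 0 := n.factorial_ne_zero
  set q := n.factorial
  let w : ℕ → ℕ := fun i => (F.coeff i).order.toNat * (q / (n - i))
  have hw : ∀ i < n, F.coeff i ≠ 0 →
      ((F.coeff i).expand q hq).order = ((w i * (n - i) : ℕ) : ℕ∞) := by
    intro i hi h0
    rw [PowerSeries.order_expand, ← PowerSeries.coe_toNat_order h0, nsmul_eq_mul, ← Nat.cast_mul]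
    have : q / (n - i) * (n - i) = q :=
      Nat.div_mul_cancel (Nat.dvd_factorial (by omega) (Nat.sub_le _ _))
    simp only [w]
    rw [mul_assoc, this, mul_comm]
  let s := (Finset.range n).filter fun i => F.coeff i ≠ 0
  have hs : s.Nonempty := by
    by_contra hs
    rw [Finset.not_nonempty_iff_eq_empty, Finset.filter_eq_empty_iff] at hs
    refine hX (ext fun i => ?_)
    rw [coeff_X_pow]
    rcases lt_trichotomy i n with hi | rfl | hi
    · rw [if_neg hi.ne]
      simpa using hs (Finset.mem_range.2 hi)
    · rw [if_pos rfl, hn, hF.coeff_natDegree]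
    · rw [if_neg hi.ne', coeff_eq_zero_of_natDegree_lt hi]
  obtain ⟨i₀, hi₀, hmin⟩ := Finset.exists_min_image s w hs
  simp only [s, Finset.mem_filter, Finset.mem_range] at hi₀ hmin
  have hd : ∀ i, ∃ d, i < n →
      (F.coeff i).expand q hq = PowerSeries.X ^ (w i₀ * (n - i)) * d := by
    intro i
    by_cases hi : i < n
    · by_cases h0 : F.coeff i = 0
      · exact ⟨0, fun _ => by simp [h0]⟩
      · have : (PowerSeries.X : PowerSeries K) ^ (w i₀ * (n - i)) ∣ (F.coeff i).expand q hq := by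
          rw [PowerSeries.X_pow_dvd_iff]
          intro m hm
          apply PowerSeries.coeff_of_lt_order
          rw [hw i hi h0]
          exact_mod_cast hm.trans_le (Nat.mul_le_mul_right _ (hmin i ⟨hi, h0⟩))
        obtain ⟨d, hd⟩ := this
        exact ⟨d, fun _ => hd⟩
    · exact ⟨0, fun h => absurd h hi⟩
  choose d hd using hd
  let H : (PowerSeries K)[X] := ∑ i ∈ Finset.range n, monomial i (d i)
  have hH : ∀ i, H.coeff i = if i < n then d i else 0 := by
    intro i
    simp only [H, finsetSum_coeff, coeff_monomial, Finset.sum_ite_eq', Finset.mem_range]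
  have hHd : H.degree < n := by
    rw [degree_lt_iff_coeff_zero]
    intro m hm
    rw [hH, if_neg hm.not_gt]
  have hG : (X ^ n + H).Monic := monic_X_pow_add hHd
  have hGd : (X ^ n + H).natDegree = n := natDegree_eq_of_degree_eq_some (by
    rw [degree_add_eq_left_of_degree_lt (by rwa [degree_X_pow]), degree_X_pow])
  have hGc : ∀ i < n, (X ^ n + H).coeff i = d i := by
    intro i hi
    rw [coeff_add, hH, if_pos hi, coeff_X_pow, if_neg hi.ne, zero_add]
  refine ⟨q, hq, w i₀, X ^ n + H, hG, hGd, ?_, ?_, i₀, hi₀.1, ?_⟩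
  · ext1 i
    rw [coeff_map, coeff_scaleRoots, hGd]
    rcases lt_trichotomy i n with hi | rfl | hi
    · rw [hGc i hi, ← pow_mul, mul_comm]
      exact hd i hi
    · have h1 : F.coeff n = 1 := hF.coeff_natDegree
      have h2 : (X ^ n + H).coeff n = 1 := by
        simpa only [Monic, leadingCoeff, hGd] using hG
      simp [h1, h2, -coeff_add]
    · rw [coeff_eq_zero_of_natDegree_lt (p := F) hi,
        coeff_eq_zero_of_natDegree_lt (by rwa [hGd]), map_zero, zero_mul]
  · intro i h0
    rcases lt_trichotomy i n with hi | rfl | hi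
    · have := hd i hi
      rw [h0, map_zero, zero_eq_mul] at this
      rw [hGc i hi]
      exact this.resolve_left (pow_ne_zero _ PowerSeries.X_ne_zero)
    · exact absurd (hF.coeff_natDegree.symm.trans h0) one_ne_zero
    · exact coeff_eq_zero_of_natDegree_lt (by rwa [hGd])
  -- At the index of minimal slope the power of T divided out is the full order, so the quotient is
  -- a unit.
  · rw [hGc i₀ hi₀.1]
    intro h
    have h1 := hw i₀ hi₀.1 hi₀.2
    rw [hd i₀ hi₀.1, PowerSeries.order_mul, PowerSeries.order_X_pow] at h1
    have h2 : (d i₀).order ≠ 0 := by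
      rwa [PowerSeries.order_ne_zero_iff_constCoeff_eq_zero]
    exact h2 (ENat.add_left_injective_of_ne_top (ENat.natCast_ne_top (w i₀ * (n - i₀)))
      (by simpa only [add_comm, zero_add] using h1))

end Newton
-- The Newton–Puiseux induction
section Puiseux

open Polynomial

/-- A finite extension of fields of characteristic zero is a triangular separable algebra. -/
lemma IsTriangularSeparable.of_finiteDimensional (K L : Type u) [Field K] [CharZero K] [Field L]
    [Algebra K L] [FiniteDimensional K L] : IsTriangularSeparable K L := by
  obtain ⟨α, hα⟩ := Field.exists_primitive_element K L
  have hint : IsIntegral K α := Algebra.IsIntegral.isIntegral α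
  have htop : Algebra.adjoin K {α} = ⊤ := by
    rw [← IntermediateField.adjoin_simple_toSubalgebra_of_isAlgebraic hint.isAlgebraic, hα,
      IntermediateField.top_toSubalgebra]
  exact .adjoin K L (minpoly K α) (.base K Function.bijective_id) (minpoly.monic hint)
    (minpoly.natDegree_pos hint) (minpoly.irreducible hint).separable
    ⟨IsAdjoinRoot.mkOfAdjoinEqTop hint htop⟩

lemma substPow_mul {K : Type u} [Field K] (R : Type u) [CommRing R] [Algebra K R] (m : ℕ)
    (hm : m ≠ 0) (F G : (PowerSeries K)[X]) :
    substPow R m hm (F * G) = substPow R m hm F * substPow R m hm G :=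
  Polynomial.map_mul _

lemma substPow_monic {K : Type u} [Field K] (R : Type u) [CommRing R] [Algebra K R] (m : ℕ)
    (hm : m ≠ 0) {F : (PowerSeries K)[X]} (hF : F.Monic) : (substPow R m hm F).Monic :=
  hF.map _

lemma natDegree_substPow {K : Type u} [Field K] (R : Type u) [CommRing R] [Nontrivial R]
    [Algebra K R] (m : ℕ) (hm : m ≠ 0) {F : (PowerSeries K)[X]} (hF : F.Monic) :
    (substPow R m hm F).natDegree = F.natDegree :=
  hF.natDegree_map _

lemma substPow_substPow {K L : Type u} [Field K] [Field L] [Algebra K L] (M : Type u) [CommRing M]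
    [Algebra K M] [Algebra L M] [IsScalarTower K L M] (m k : ℕ) (hm : m ≠ 0) (hk : k ≠ 0)
    (F : (PowerSeries K)[X]) :
    substPow M k hk (substPow L m hm F) = substPow M (k * m) (mul_ne_zero hk hm) F := by
  unfold substPow
  rw [Polynomial.map_map]
  congr 1
  ext1 φ
  simp only [AlgHom.toRingHom_eq_coe, RingHom.coe_comp, RingHom.coe_coe, Function.comp_apply]
  rw [PowerSeries.map_expand, PowerSeries.expand_mul, IsScalarTower.algebraMap_eq K L M,
    PowerSeries.map_comp]
  rfl

/-- `F(T ^ m, Y)` splits over `L⟦T⟧` for some finite extension `L` of `K` and some `m ≠ 0`. -/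
def PuiseuxSplits (K : Type u) [Field K] (F : (PowerSeries K)[X]) : Prop :=
  ∃ (L : Type u) (_ : Field L) (_ : Algebra K L), FiniteDimensional K L ∧
    ∃ (m : ℕ) (hm : m ≠ 0), (substPow L m hm F).Splits

namespace PuiseuxSplits

variable {K : Type u} [Field K] {F : (PowerSeries K)[X]}

lemma of_splits (h : F.Splits) : PuiseuxSplits K F :=
  ⟨K, inferInstance, inferInstance, inferInstance, 1, one_ne_zero, h.map _⟩

lemma of_substPow (L : Type u) [Field L] [Algebra K L] [FiniteDimensional K L] (m : ℕ) (hm : m ≠ 0)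
    (h : PuiseuxSplits L (substPow L m hm F)) : PuiseuxSplits K F := by
  obtain ⟨M, _, _, _, k, hk, h⟩ := h
  let _ : Algebra K M := ((algebraMap L M).comp (algebraMap K L)).toAlgebra
  have : IsScalarTower K L M := .of_algebraMap_eq' rfl
  refine ⟨M, inferInstance, inferInstance, FiniteDimensional.trans K L M, k * m,
    mul_ne_zero hk hm, ?_⟩
  rwa [← substPow_substPow (L := L) M m k hm hk]

lemma of_taylor (c : PowerSeries K) (h : PuiseuxSplits K (taylor c F)) : PuiseuxSplits K F := by
  obtain ⟨L, _, _, _, m, hm, h⟩ := h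
  refine ⟨L, inferInstance, inferInstance, inferInstance, m, hm, ?_⟩
  rw [substPow, map_taylor] at h
  have h' := h.taylor (-(((PowerSeries.expand m hm : PowerSeries L →ₐ[L] PowerSeries L).toRingHom.comp
    (PowerSeries.map (algebraMap K L))) c))
  rwa [taylor_taylor, neg_add_cancel, taylor_zero] at h'

lemma scaleRoots (hF : F.Monic) (r : PowerSeries K) (h : PuiseuxSplits K F) :
    PuiseuxSplits K (F.scaleRoots r) := by
  obtain ⟨L, _, _, _, m, hm, h⟩ := h
  refine ⟨L, inferInstance, inferInstance, inferInstance, m, hm, ?_⟩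
  rw [substPow, map_scaleRoots _ _ _ (by simp [hF.leadingCoeff])]
  exact h.scaleRoots _

/-- The factors are split one after the other: G is treated only after the base change that splits
F, hence the hypothesis over every L and m. -/
lemma mul {G : (PowerSeries K)[X]} (hF : PuiseuxSplits K F)
    (hG : ∀ (L : Type u) [Field L] [Algebra K L] (m : ℕ) (hm : m ≠ 0),
      PuiseuxSplits L (substPow L m hm G)) : PuiseuxSplits K (F * G) := by
  obtain ⟨L, _, _, _, m, hm, h⟩ := hF
  refine of_substPow L m hm ?_
  obtain ⟨M, _, _, _, k, hk, h'⟩ := hG L m hm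
  refine ⟨M, inferInstance, inferInstance, inferInstance, k, hk, ?_⟩
  rw [substPow_mul, substPow_mul]
  exact (h.map _).mul h'

end PuiseuxSplits

/-- A monic polynomial over a field of characteristic zero with vanishing subleading coefficient
that splits and is not a power of the variable has a root `a` such that it factors as
`(X - a) ^ k * h` with both factors of smaller degree and coprime. -/
lemma Polynomial.exists_coprime_factorization {K : Type*} [Field K] [CharZero K] {g : K[X]}
    (hg : g.Monic) {n : ℕ} (hn : g.natDegree = n + 1) (h0 : g.coeff n = 0) (hX : g ≠ X ^ (n + 1))
    (hs : g.Splits) :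
    ∃ a b : K[X], a.Monic ∧ b.Monic ∧ IsCoprime a b ∧ g = a * b ∧ a.natDegree < n + 1 ∧
      b.natDegree < n + 1 := by
  obtain ⟨r, hr⟩ := hs.exists_eval_eq_zero (by
    rw [degree_eq_natDegree hg.ne_zero, hn]
    exact_mod_cast n.succ_ne_zero)
  obtain ⟨b, hb, hrb⟩ := exists_eq_pow_rootMultiplicity_mul_and_not_dvd g hg.ne_zero r
  set k := g.rootMultiplicity r
  have hk : 0 < k := (rootMultiplicity_pos hg.ne_zero).2 hr
  have ha : ((X - C r) ^ k).Monic := (monic_X_sub_C r).pow k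
  have hbm : b.Monic := ha.of_mul_monic_left (hb ▸ hg)
  have had : ((X - C r) ^ k).natDegree = k := by
    rw [(monic_X_sub_C r).natDegree_pow, natDegree_X_sub_C, mul_one]
  have hdeg : k + b.natDegree = n + 1 := by
    rw [← hn, hb, ha.natDegree_mul hbm, had]
  refine ⟨(X - C r) ^ k, b, ha, hbm, ?_, hb, ?_, by omega⟩
  · exact IsCoprime.pow_left (((irreducible_X_sub_C r).coprime_iff_not_dvd).2 hrb)
  · rw [had]
    -- A single root r would give g = (X - r)^(n+1) with subleading coefficient -(n+1)r = 0, hence r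
    -- = 0 and g = X^(n+1).
    by_contra hlt
    have hkn : k = n + 1 := by omega
    have hb1 : b = 1 := hbm.natDegree_eq_zero.1 (by omega)
    rw [hb1, mul_one, hkn] at hb
    have hnc : g.nextCoeff = 0 := by
      rw [nextCoeff_of_natDegree_pos (by omega), hn, Nat.add_sub_cancel, h0]
    rw [hb, (monic_X_sub_C r).nextCoeff_pow, nextCoeff_X_sub_C, nsmul_eq_mul, mul_eq_zero,
      neg_eq_zero] at hnc
    have hr0 : r = 0 := hnc.resolve_left (by exact_mod_cast n.succ_ne_zero)
    exact hX (by rw [hb, hr0, C_0, sub_zero])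

/-- The Newton–Puiseux theorem. -/
theorem puiseuxSplits_of_monic (n : ℕ) : ∀ (K : Type u) [Field K] [CharZero K]
    (F : (PowerSeries K)[X]), F.Monic → F.natDegree = n → PuiseuxSplits K F := by
  induction n using Nat.strong_induction_on with
  | _ n ih =>
  intro K _ _ F hF hn
  rcases n with _ | n
  · exact .of_splits (.of_natDegree_eq_zero hn)
  obtain ⟨c, hc⟩ := exists_coeff_taylor_eq_zero hF hn
  refine .of_taylor c ?_
  have hF' : (taylor c F).Monic := by rwa [Monic, leadingCoeff_taylor]
  have hn' : (taylor c F).natDegree = n + 1 := by rw [natDegree_taylor, hn]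
  generalize taylor c F = F at hF' hn' hc
  by_cases hX : F = X ^ F.natDegree
  · rw [hX]
    exact .of_splits (.X_pow _)
  obtain ⟨q, hq, p, G, hG, hGd, hFG, hGc, i, hi, hGi⟩ := exists_map_expand_eq_scaleRoots hF' hX
  have hFG' : substPow K q hq F = G.scaleRoots (PowerSeries.X ^ p) := by
    rw [← hFG, substPow]
    congr 1
  refine .of_substPow K q hq ?_
  rw [hFG']
  refine .scaleRoots hG _ ?_
  let L := (G.map PowerSeries.constantCoeff).SplittingField
  have : CharZero L := charZero_of_injective_algebraMap (algebraMap K L).injective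
  -- Exponent 1: only the constants are extended, with no further ramification.
  refine .of_substPow L 1 one_ne_zero ?_
  have hG' := substPow_monic L 1 one_ne_zero hG
  have hGd' := natDegree_substPow L 1 one_ne_zero hG
  have hmap : (substPow L 1 one_ne_zero G).map PowerSeries.constantCoeff =
      (G.map PowerSeries.constantCoeff).map (algebraMap K L) := by
    ext i
    rw [coeff_map, substPow, coeff_map, coeff_map, coeff_map]
    simp only [AlgHom.toRingHom_eq_coe, RingHom.coe_comp, RingHom.coe_coe, Function.comp_apply]
    rw [PowerSeries.constantCoeff_expand]
    simp only [← PowerSeries.coeff_zero_eq_constantCoeff_apply, PowerSeries.coeff_map]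
  have hsplit : ((substPow L 1 one_ne_zero G).map PowerSeries.constantCoeff).Splits := by
    rw [hmap]
    exact SplittingField.splits _
  obtain ⟨a, b, ha, hb, hab, hg, hda, hdb⟩ := exists_coprime_factorization (n := n)
    (hG'.map PowerSeries.constantCoeff)
    (by rw [hG'.natDegree_map, hGd', hGd, hn'])
    (by rw [hmap, coeff_map, coeff_map, hGc n hc, map_zero, map_zero])
    (fun h => by
      have h2 := congrArg (coeff · i) h
      simp only [hmap, coeff_map, coeff_X_pow] at h2
      rw [if_neg (by omega), map_eq_zero] at h2
      exact hGi h2)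
    hsplit
  obtain ⟨P, Q, hP, hQ, hPd, hQd, hPQ⟩ := exists_monic_mul_of_map_constantCoeff hG' ha hb hab hg
  rw [← hPQ]
  refine .mul (ih _ (hPd ▸ hda) L P hP rfl) fun M _ _ m hm => ?_
  have : CharZero M := charZero_of_injective_algebraMap (algebraMap L M).injective
  exact ih _ (hQd ▸ hdb) M _ (substPow_monic M m hm hQ) (natDegree_substPow M m hm hQ)

/-- A monic polynomial that splits over a domain is a product of linear factors indexed by
`Fin` of its degree. -/
lemma Polynomial.Splits.exists_eq_prod_fin {R : Type*} [CommRing R] [IsDomain R] {f : R[X]}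
    (hf : f.Splits) (hm : f.Monic) {n : ℕ} (hn : f.natDegree = n) :
    ∃ η : Fin n → R, f = ∏ i, (X - C (η i)) := by
  obtain ⟨l, hl⟩ := Quot.exists_rep f.roots
  have hlen : l.length = n := by
    rw [← hn, hf.natDegree_eq_card_roots, ← hl]
    rfl
  subst hlen
  refine ⟨fun i => l[i], ?_⟩
  conv_lhs => rw [hf.eq_prod_roots_of_monic hm, ← hl]
  change (Multiset.map _ (l : Multiset R)).prod = _
  rw [Multiset.map_coe, Multiset.prod_coe, ← List.prod_ofFn]
  congr 1
  apply List.ext_getElem <;> simp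

end Puiseux

theorem mainTheorem5 (K : Type u) [Field K] [CharZero K]
    (F : Polynomial (PowerSeries K)) (hF : F.Monic)
    (hsep : (F.map (algebraMap (PowerSeries K) (LaurentSeries K))).Separable) :
    ∃ (R : Type u) (_ : CommRing R) (_ : Algebra K R), IsTriangularSeparable K R ∧
      ∃ (m : ℕ) (hm : m ≠ 0) (η : Fin F.natDegree → PowerSeries R),
        substPow R m hm F = ∏ i, (Polynomial.X - Polynomial.C (η i)) := by
  obtain ⟨L, _, _, _, m, hm, h⟩ := puiseuxSplits_of_monic _ K F hF rfl
  exact ⟨L, inferInstance, inferInstance, .of_finiteDimensional K L, m, hm,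
    h.exists_eq_prod_fin (substPow_monic L m hm hF) (natDegree_substPow L m hm hF)⟩
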